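/- **Setting.** Let $f:\mathbb{R}^N\to\mathbb{R}$ be strictly convex and self-concordant with constant $2$: $f$ is convex and $C^3$, and $|\varphi'''(t)|\le 2\,\varphi''(t)^{3/2}$ for every restriction $\varphi(t)=f(x+tu)$ to a line. Let $P\in\mathbb{R}^{N\times n}$ have full column rank $n$, let $R=P^{T}$ and $Q(x)=R\,\nabla^2 f(x)\,P$. Put $$\lambda(x)=\big(\nabla f(x)^T[\nabla^2 f(x)]^{-1}\nabla f(x)\big)^{1/2},\qquad \hat\lambda(x)=\big((R\nabla f(x))^T Q(x)^{-1}R\nabla f(x)\big)^{1/2}$$ (the Newton decrement and the approximate decrement). **Algorithm (SIGMA).** The inputs are $\mu\in(0,1)$, $\alpha\in(0,\tfrac12)$, $\beta\in(0,1)$, $\nu\in(0,0.68^2)$, $\epsilon\in(\nu,0.68^2)$, $P$ and $x_0\in\mathbb{R}^N$. At $x_k$: 1. If $\hat\lambda(x_k)>\mu\lambda(x_k)$ and $\hat\lambda(x_k)>\nu$, take the (deterministic Galerkin) coarse direction $d=-P\,Q(x_k)^{-1}R\nabla f(x_k)$; otherwise take the Newton direction $d=-[\nabla^2 f(x_k)]^{-1}\nabla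 f(x_k)$. 2. Quit if $-\langle\nabla f(x_k),d\rangle\le\epsilon$. 3. Let $t_k$ be the first element of $1,\beta,\beta^2,\dots$ with $f(x_k+t_kd)\le f(x_k)+\alpha t_k\nabla f(x_k)^Td$. 4. Set $x_{k+1}=x_k+t_kd$ and repeat. **Theorem.** Let $\mu\in(0,1)$, $\alpha\in(0,\tfrac12)$, $\beta\in(0,1)$, and put $$e=\sqrt{1-\mu^2},\qquad \eta_\mu=\frac{3-\sqrt{5+4e}}{2}.$$ There are $\gamma>0$ and $\eta\in\big(0,\tfrac{3-\sqrt5}{2}\big)$, depending only on $\mu,\alpha,\beta$, with $\eta=\min\{\eta_\mu,\tfrac{1-2\alpha}{2}\}$ (so $\eta=\eta_\mu$ when $\alpha\le\tfrac12-\eta_\mu$), such that for all $N,n,f,P,\nu,\epsilon,x_0$ as above and every step $k$ that the algorithm carries out with the coarse direction: (i) (damped phase) if $\hat\lambda(x_k)>\eta$, then $f(x_{k+1})-f(x_k)\le-\gamma$; (ii) (super-linear local phase) if $\hat\lambda(x_k)\le\eta$, then the unit step $t_k=1$ is selected, and $$\hat\lambda(x_{k+1})<\hat\lambda(x_k),\qquad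 \lambda(x_{k+1})<\lambda(x_k),\qquad \lambda(x_{k+1})\le\frac{e+\hat\lambda(x_k)}{(1-\hat\lambda(x_k))^2}\,\lambda(x_k);$$ (iii) the three inequalities in (ii) hold, more generally, whenever $\hat\lambda(x_k)\le\eta_\mu$ and $t_k=1$. -/

import Mathlib

open Matrix

noncomputable section

namespace SIGMA

/-- A convex function on all of `ℝ^N` is self-concordant with constant `M` if it is three times
continuously differentiable and every restriction `φ t = f (x + t u)` to a line satisfies
`|φ'''| ≤ M (φ'')^(3/2)`. -/
def IsSelfConcordant {N : ℕ} (M : ℝ) (f : EuclideanSpace ℝ (Fin N) → ℝ) : Prop :=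
  ConvexOn ℝ Set.univ f ∧ ContDiff ℝ 3 f ∧
    ∀ (x u : EuclideanSpace ℝ (Fin N)) (t : ℝ),
      |iteratedDeriv 3 (fun s : ℝ => f (x + s • u)) t| ≤
        M * (iteratedDeriv 2 (fun s : ℝ => f (x + s • u)) t) ^ (3 / 2 : ℝ)

/-- The Hessian matrix `∇² f(x)`. -/
def hessian {N : ℕ} (f : EuclideanSpace ℝ (Fin N) → ℝ) (x : EuclideanSpace ℝ (Fin N)) :
    Matrix (Fin N) (Fin N) ℝ :=
  Matrix.of fun i j =>
    fderiv ℝ (fderiv ℝ f) x (EuclideanSpace.single i 1) (EuclideanSpace.single j 1)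

/-- The reduced (Galerkin) Hessian `Q_H(x) = R ∇² f(x) P`, where `R = Pᵀ`. -/
def reducedHessian {N n : ℕ} (f : EuclideanSpace ℝ (Fin N) → ℝ)
    (P : Matrix (Fin N) (Fin n) ℝ) (x : EuclideanSpace ℝ (Fin N)) :
    Matrix (Fin n) (Fin n) ℝ :=
  Pᵀ * hessian f x * P

/-- The restricted gradient `R ∇ f(x)`, where `R = Pᵀ`. -/
def reducedGradient {N n : ℕ} (f : EuclideanSpace ℝ (Fin N) → ℝ)
    (P : Matrix (Fin N) (Fin n) ℝ) (x : EuclideanSpace ℝ (Fin N)) : Fin n → ℝ :=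
  Pᵀ *ᵥ (gradient f x).ofLp

/-- The Newton decrement `λ(x) = (∇f(x)ᵀ [∇² f(x)]⁻¹ ∇f(x))^(1/2)`. -/
def newtonDecrement {N : ℕ} (f : EuclideanSpace ℝ (Fin N) → ℝ)
    (x : EuclideanSpace ℝ (Fin N)) : ℝ :=
  √((gradient f x).ofLp ⬝ᵥ ((hessian f x)⁻¹ *ᵥ (gradient f x).ofLp))

/-- The approximate decrement `λ̂(x) = ((R ∇f(x))ᵀ [Q_H(x)]⁻¹ R ∇f(x))^(1/2)`. -/
def approxDecrement {N n : ℕ} (f : EuclideanSpace ℝ (Fin N) → ℝ)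
    (P : Matrix (Fin N) (Fin n) ℝ) (x : EuclideanSpace ℝ (Fin N)) : ℝ :=
  √(reducedGradient f P x ⬝ᵥ ((reducedHessian f P x)⁻¹ *ᵥ reducedGradient f P x))

/-- The fine (Newton) direction `- [∇² f(x)]⁻¹ ∇f(x)`. -/
def fineDirection {N : ℕ} (f : EuclideanSpace ℝ (Fin N) → ℝ)
    (x : EuclideanSpace ℝ (Fin N)) : EuclideanSpace ℝ (Fin N) :=
  WithLp.toLp 2 (-((hessian f x)⁻¹ *ᵥ (gradient f x).ofLp))

/-- The coarse (Galerkin) direction `- P [R ∇² f(x) P]⁻¹ R ∇f(x)`. -/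
def coarseDirection {N n : ℕ} (f : EuclideanSpace ℝ (Fin N) → ℝ)
    (P : Matrix (Fin N) (Fin n) ℝ) (x : EuclideanSpace ℝ (Fin N)) :
    EuclideanSpace ℝ (Fin N) :=
  WithLp.toLp 2 (-(P *ᵥ ((reducedHessian f P x)⁻¹ *ᵥ reducedGradient f P x)))

/-- The test by which the algorithm employs the coarse direction at `x`:
`λ̂(x) > μ λ(x)` and `λ̂(x) > ν`. -/
def UsesCoarse {N n : ℕ} (μ ν : ℝ) (f : EuclideanSpace ℝ (Fin N) → ℝ)
    (P : Matrix (Fin N) (Fin n) ℝ) (x : EuclideanSpace ℝ (Fin N)) : Prop :=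
  μ * newtonDecrement f x < approxDecrement f P x ∧ ν < approxDecrement f P x

open Classical in
/-- The search direction of the algorithm at `x`: coarse if the test succeeds, else Newton. -/
def direction {N n : ℕ} (μ ν : ℝ) (f : EuclideanSpace ℝ (Fin N) → ℝ)
    (P : Matrix (Fin N) (Fin n) ℝ) (x : EuclideanSpace ℝ (Fin N)) :
    EuclideanSpace ℝ (Fin N) :=
  if UsesCoarse μ ν f P x then coarseDirection f P x else fineDirection f x

/-- The Armijo condition `f(x + t d) ≤ f(x) + α t ∇f(x)ᵀ d`. -/
def Armijo {N : ℕ} (α : ℝ) (f : EuclideanSpace ℝ (Fin N) → ℝ)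
    (x d : EuclideanSpace ℝ (Fin N)) (t : ℝ) : Prop :=
  f (x + t • d) ≤ f x + α * t * inner ℝ (gradient f x) d

/-- `t` is returned by the backtracking loop that starts at `1` and replaces `t` by `β t` as long
as the Armijo condition fails. -/
def IsBacktrackingStep {N : ℕ} (α β : ℝ) (f : EuclideanSpace ℝ (Fin N) → ℝ)
    (x d : EuclideanSpace ℝ (Fin N)) (t : ℝ) : Prop :=
  ∃ j : ℕ, t = β ^ j ∧ Armijo α f x d (β ^ j) ∧ ∀ i < j, ¬ Armijo α f x d (β ^ i)

/-- The quit test `-⟨∇f(x), d⟩ ≤ ε` of the algorithm at `x`. -/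
def Quits {N n : ℕ} (μ ν ε : ℝ) (f : EuclideanSpace ℝ (Fin N) → ℝ)
    (P : Matrix (Fin N) (Fin n) ℝ) (x : EuclideanSpace ℝ (Fin N)) : Prop :=
  -inner ℝ (gradient f x) (direction μ ν f P x) ≤ ε

/-- `x 0, x 1, …` are the iterates and `t 0, t 1, …` the step sizes of a run of SIGMA which makes
exactly `K` steps (`K = ⊤` if it never quits); the values `x k` with `k > K` and `t k` with `k ≥ K`
are irrelevant. -/
structure IsRun {N n : ℕ} (μ α β ν ε : ℝ) (f : EuclideanSpace ℝ (Fin N) → ℝ)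
    (P : Matrix (Fin N) (Fin n) ℝ) (K : ℕ∞)
    (x : ℕ → EuclideanSpace ℝ (Fin N)) (t : ℕ → ℝ) : Prop where
  not_quits : ∀ k : ℕ, (k : ℕ∞) < K → ¬ Quits μ ν ε f P (x k)
  lineSearch : ∀ k : ℕ, (k : ℕ∞) < K →
    IsBacktrackingStep α β f (x k) (direction μ ν f P (x k)) (t k)
  update : ∀ k : ℕ, (k : ℕ∞) < K → x (k + 1) = x k + t k • direction μ ν f P (x k)
  quits : ∀ k : ℕ, (k : ℕ∞) = K → Quits μ ν ε f P (x k)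

/-- The contraction parameter `e = √(1 - μ²)`. -/
def contraction (μ : ℝ) : ℝ := √(1 - μ ^ 2)

/-- The radius `(3 - √(5 + 4e)) / 2` of the region of fast convergence. -/
def fastRadius (μ : ℝ) : ℝ := (3 - √(5 + 4 * contraction μ)) / 2

end SIGMA

end

/-! In the local norm ‖v‖ₓ = √(D²f(x)[v,v]), the coarse direction d is the orthogonal projection of
the Newton direction onto the range of P. Hence λ̂ = ‖d‖ₓ and ⟨∇f, d⟩ = -λ̂², while the residual ∇f
+ ∇²f d vanishes on the range of P and has dual norm at most √(λ² - λ̂²), which the coarse test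
bounds by eλ (`abs_fderiv_add_fderiv_fderiv_le`).

Write r = λ̂(x). If r < 1, self-concordance shrinks local norms by at most the factor 1 - r between
x and x + d, and the Taylor remainder of the gradient has dual norm at most r²/(1-r). Testing the
new gradient on the range of P gives λ̂(x+d) ≤ r²/(1-r)². Testing it on all vectors gives λ(x+d) ≤
(eλ + r²/(1-r))/(1-r), and r ≤ λ turns this into the stated factor (e+r)/(1-r)². The radius η_μ is
where that factor equals 1 (`decrement_coarse_step`).

For the line search, f(x+sd) ≤ f(x) - sr² - sr - log(1-sr) when sr < 1. The step s = 1/(1+r) then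
always passes the Armijo test, so backtracking loses at most a factor β and the decrease is bounded
below; for small r the step s = 1 passes as well.

Two facts feed these estimates: the polarised bound |D³f[u,v,v]| ≤ 2‖u‖‖v‖², since self-concordance
only controls the diagonal, and definiteness of the Hessian, which strict convexity alone does not
give. -/

noncomputable section

namespace SIGMA

/-! ### Polarisation of a binary cubic form -/

section

/-- Two-dimensional case of Banach's theorem that a symmetric trilinear form is bounded by its
diagonal. With (p, m) = ρ(cos 3τ, sin 3τ), the left side is ρ times a convex combination of the
cubic's values at the angles τ, τ + 2π/3 and τ + 4π/3. -/
theorem abs_linear_le_of_abs_binary_cubic_le {a b c d M : ℝ}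
    (h : ∀ s t : ℝ, s ^ 2 + t ^ 2 = 1 →
      |a * s ^ 3 + 3 * b * s ^ 2 * t + 3 * c * s * t ^ 2 + d * t ^ 3| ≤ M) (p m : ℝ) :
    |p * a + m * b| ≤ M * √(p ^ 2 + m ^ 2) := by
  obtain ⟨ρ, τ, hρ, rfl, rfl⟩ : ∃ ρ τ : ℝ, 0 ≤ ρ ∧ p = ρ * Real.cos (3 * τ) ∧
      m = ρ * Real.sin (3 * τ) := by
    refine ⟨‖(⟨p, m⟩ : ℂ)‖, Complex.arg ⟨p, m⟩ / 3, norm_nonneg _, ?_, ?_⟩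
    · rw [mul_div_cancel₀ _ (three_ne_zero), Complex.norm_mul_cos_arg]
    · rw [mul_div_cancel₀ _ (three_ne_zero), Complex.norm_mul_sin_arg]
  have hsq : √((ρ * Real.cos (3 * τ)) ^ 2 + (ρ * Real.sin (3 * τ)) ^ 2) = ρ := by
    rw [← Real.sqrt_sq hρ]
    congr 1
    rw [Real.sqrt_sq hρ]
    linear_combination ρ ^ 2 * Real.cos_sq_add_sin_sq (3 * τ)
  rw [hsq, Real.cos_three_mul, Real.sin_three_mul]
  have hcs := Real.cos_sq_add_sin_sq τ
  have hr : √3 ^ 2 = 3 := Real.sq_sqrt (by norm_num)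
  generalize Real.cos τ = C at *
  generalize Real.sin τ = S at *
  generalize √3 = r at *
  have h0 := h C S hcs
  have h1 := h (-(C + r * S) / 2) ((r * C - S) / 2)
    (by linear_combination (C ^ 2 + S ^ 2) / 4 * hr + hcs)
  have h2 := h (-(C - r * S) / 2) (-(r * C + S) / 2)
    (by linear_combination (C ^ 2 + S ^ 2) / 4 * hr + hcs)
  set F₀ := a * C ^ 3 + 3 * b * C ^ 2 * S + 3 * c * C * S ^ 2 + d * S ^ 3 with hF₀
  set F₁ := a * (-(C + r * S) / 2) ^ 3 + 3 * b * (-(C + r * S) / 2) ^ 2 * ((r * C - S) / 2) +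
    3 * c * (-(C + r * S) / 2) * ((r * C - S) / 2) ^ 2 + d * ((r * C - S) / 2) ^ 3 with hF₁
  set F₂ := a * (-(C - r * S) / 2) ^ 3 + 3 * b * (-(C - r * S) / 2) ^ 2 * (-(r * C + S) / 2) +
    3 * c * (-(C - r * S) / 2) * (-(r * C + S) / 2) ^ 2 + d * (-(r * C + S) / 2) ^ 3 with hF₂
  have hr4 : r ^ 4 = 9 := by linear_combination (r ^ 2 + 3) * hr
  -- The weights are squares, and `hone` shows that they sum to 1. The factor (C² + S²)² = 1
  -- homogenises the identity so that, given r² = 3, it is purely polynomial.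
  have key : (C ^ 2 + S ^ 2) ^ 2 *
      ((C ^ 3 - 3 * C * S ^ 2) * a + (3 * C ^ 2 * S - S ^ 3) * b) =
      ((3 * C ^ 2 - S ^ 2) / 3) ^ 2 * F₀ + (2 * S * (r * C + S) / 3) ^ 2 * F₁
      + (2 * S * (r * C - S) / 3) ^ 2 * F₂ := by
    rw [hF₀, hF₁, hF₂]
    ring_nf
    simp only [hr, hr4]
    ring
  have hone : ((3 * C ^ 2 - S ^ 2) / 3) ^ 2 + (2 * S * (r * C + S) / 3) ^ 2
      + (2 * S * (r * C - S) / 3) ^ 2 = 1 := by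
    linear_combination (8 * S ^ 2 * C ^ 2 / 9) * hr + (C ^ 2 + S ^ 2 + 1) * hcs
  have heq : ρ * (4 * C ^ 3 - 3 * C) * a + ρ * (3 * S - 4 * S ^ 3) * b =
      ρ * (((3 * C ^ 2 - S ^ 2) / 3) ^ 2 * F₀ + (2 * S * (r * C + S) / 3) ^ 2 * F₁
      + (2 * S * (r * C - S) / 3) ^ 2 * F₂) := by
    rw [← key, hcs]
    linear_combination 3 * ρ * (C * a - S * b) * hcs
  rw [heq, abs_mul, abs_of_nonneg hρ, mul_comm]
  refine mul_le_mul_of_nonneg_right ?_ hρ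
  calc _ ≤ ((3 * C ^ 2 - S ^ 2) / 3) ^ 2 * |F₀| + (2 * S * (r * C + S) / 3) ^ 2 * |F₁|
      + (2 * S * (r * C - S) / 3) ^ 2 * |F₂| := by
        refine (abs_add_three _ _ _).trans_eq ?_
        simp only [abs_mul _ F₀, abs_mul _ F₁, abs_mul _ F₂, abs_sq]
    _ ≤ ((3 * C ^ 2 - S ^ 2) / 3) ^ 2 * M + (2 * S * (r * C + S) / 3) ^ 2 * M
      + (2 * S * (r * C - S) / 3) ^ 2 * M := by gcongr
    _ = M := by rw [← add_mul, ← add_mul, hone, one_mul]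

/-! ### Derivatives along lines and their symmetry -/

variable {E : Type*} [NormedAddCommGroup E] [NormedSpace ℝ E]

theorem _root_.HasDerivAt.clm_apply_const {F G : Type*} [NormedAddCommGroup F] [NormedSpace ℝ F]
    [NormedAddCommGroup G] [NormedSpace ℝ G] {c : ℝ → F →L[ℝ] G} {c' : F →L[ℝ] G} {t : ℝ}
    (hc : HasDerivAt c c' t) (v : F) : HasDerivAt (fun s => c s v) (c' v) t :=
  (hc.clm_apply (hasDerivAt_const t v)).congr_deriv (by simp)

theorem hasDerivAt_comp_line {F : Type*} [NormedAddCommGroup F] [NormedSpace ℝ F] {g : E → F}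
    (hg : Differentiable ℝ g) (x u : E) (t : ℝ) :
    HasDerivAt (fun s : ℝ => g (x + s • u)) (fderiv ℝ g (x + t • u) u) t := by
  have h : HasDerivAt (fun s : ℝ => x + s • u) u t := by
    simpa using ((hasDerivAt_id t).smul_const u).const_add x
  exact (hg _).hasFDerivAt.comp_hasDerivAt t h

variable {f : E → ℝ}

theorem differentiable_fderiv_fderiv (hf : ContDiff ℝ 3 f) :
    Differentiable ℝ (fderiv ℝ (fderiv ℝ f)) :=
  ((hf.fderiv_right (m := 2) (by norm_num)).fderiv_right (m := 1) (by norm_num)).differentiable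
    (by norm_num)

theorem differentiable_fderiv (hf : ContDiff ℝ 3 f) : Differentiable ℝ (fderiv ℝ f) :=
  (hf.fderiv_right (m := 2) (by norm_num)).differentiable (by norm_num)

theorem hasDerivAt_line (hf : ContDiff ℝ 3 f) (x u : E) (t : ℝ) :
    HasDerivAt (fun s : ℝ => f (x + s • u)) (fderiv ℝ f (x + t • u) u) t :=
  hasDerivAt_comp_line (hf.differentiable (by norm_num)) x u t

theorem hasDerivAt_fderiv_line (hf : ContDiff ℝ 3 f) (x u w : E) (t : ℝ) :
    HasDerivAt (fun s : ℝ => fderiv ℝ f (x + s • u) w)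
      (fderiv ℝ (fderiv ℝ f) (x + t • u) u w) t :=
  (hasDerivAt_comp_line (differentiable_fderiv hf) x u t).clm_apply_const w

theorem hasDerivAt_fderiv_fderiv_line (hf : ContDiff ℝ 3 f) (x u v w : E) (t : ℝ) :
    HasDerivAt (fun s : ℝ => fderiv ℝ (fderiv ℝ f) (x + s • u) v w)
      (fderiv ℝ (fderiv ℝ (fderiv ℝ f)) (x + t • u) u v w) t := by
  have h := hasDerivAt_comp_line (F := E →L[ℝ] E →L[ℝ] ℝ)
    (differentiable_fderiv_fderiv hf) x u t
  have h' := h.clm_apply_const v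
  exact h'.clm_apply_const w

theorem iteratedDeriv_two_line (hf : ContDiff ℝ 3 f) (x u : E) :
    iteratedDeriv 2 (fun s : ℝ => f (x + s • u)) =
      fun t => fderiv ℝ (fderiv ℝ f) (x + t • u) u u := by
  rw [iteratedDeriv_succ, iteratedDeriv_one,
    funext fun t => (hasDerivAt_line hf x u t).deriv]
  exact funext fun t => (hasDerivAt_fderiv_line hf x u u t).deriv

theorem iteratedDeriv_three_line (hf : ContDiff ℝ 3 f) (x u : E) :
    iteratedDeriv 3 (fun s : ℝ => f (x + s • u)) =
      fun t => fderiv ℝ (fderiv ℝ (fderiv ℝ f)) (x + t • u) u u u := by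
  rw [iteratedDeriv_succ, iteratedDeriv_two_line hf]
  exact funext fun t => (hasDerivAt_fderiv_fderiv_line hf x u u u t).deriv

theorem fderiv_fderiv_symm (hf : ContDiff ℝ 3 f) (x v w : E) :
    fderiv ℝ (fderiv ℝ f) x v w = fderiv ℝ (fderiv ℝ f) x w v :=
  (hf.contDiffAt.isSymmSndFDerivAt (by simp; norm_num)).eq v w

theorem fderiv_fderiv_fderiv_swap_left (hf : ContDiff ℝ 3 f) (x u v w : E) :
    fderiv ℝ (fderiv ℝ (fderiv ℝ f)) x u v w = fderiv ℝ (fderiv ℝ (fderiv ℝ f)) x v u w :=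
  DFunLike.congr_fun (((hf.fderiv_right (m := 2) (by norm_num)).contDiffAt.isSymmSndFDerivAt
    (by simp)).eq u v) w

theorem fderiv_fderiv_fderiv_swap_right (hf : ContDiff ℝ 3 f) (x u v w : E) :
    fderiv ℝ (fderiv ℝ (fderiv ℝ f)) x u v w = fderiv ℝ (fderiv ℝ (fderiv ℝ f)) x u w v := by
  have h := hasDerivAt_fderiv_fderiv_line hf x u v w 0
  simp only [fderiv_fderiv_symm hf _ v w] at h
  simpa using h.unique (hasDerivAt_fderiv_fderiv_line hf x u w v 0)

/-- The norm `√(D²f(x)[v, v])` defined by the Hessian at `x`. -/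
def localNorm (f : E → ℝ) (x v : E) : ℝ := √(fderiv ℝ (fderiv ℝ f) x v v)

/-- Self-concordance with constant `2` and everywhere positive definite second derivative. -/
structure IsNondegenerateSelfConcordant (f : E → ℝ) : Prop where
  contDiff : ContDiff ℝ 3 f
  pos : ∀ x v, v ≠ 0 → 0 < fderiv ℝ (fderiv ℝ f) x v v
  abs_third_le : ∀ x v,
    |fderiv ℝ (fderiv ℝ (fderiv ℝ f)) x v v v| ≤ 2 * localNorm f x v ^ 3

theorem localNorm_nonneg (f : E → ℝ) (x v : E) : 0 ≤ localNorm f x v := Real.sqrt_nonneg _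

theorem localNorm_neg (f : E → ℝ) (x v : E) : localNorm f x (-v) = localNorm f x v := by
  simp [localNorm]

theorem le_of_second_deriv_le {h h' h'' F F' F'' : ℝ → ℝ} {b : ℝ} (hb : 0 ≤ b)
    (hh : ∀ s ∈ Set.Icc 0 b, HasDerivAt h (h' s) s)
    (hh' : ∀ s ∈ Set.Icc 0 b, HasDerivAt h' (h'' s) s)
    (hF : ∀ s ∈ Set.Icc 0 b, HasDerivAt F (F' s) s)
    (hF' : ∀ s ∈ Set.Icc 0 b, HasDerivAt F' (F'' s) s)
    (h0 : h 0 ≤ F 0) (h0' : h' 0 ≤ F' 0) (hle : ∀ s ∈ Set.Icc 0 b, h'' s ≤ F'' s) :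
    h b ≤ F b := by
  have key : ∀ ⦃s⦄, s ∈ Set.Icc 0 b → h' s ≤ F' s :=
    image_le_of_deriv_right_le_deriv_boundary
      (fun s hs => (hh' s hs).continuousAt.continuousWithinAt)
      (fun s hs => (hh' s (Set.Ico_subset_Icc_self hs)).hasDerivWithinAt) h0'
      (fun s hs => (hF' s hs).continuousAt.continuousWithinAt)
      (fun s hs => (hF' s (Set.Ico_subset_Icc_self hs)).hasDerivWithinAt)
      fun s hs => hle s (Set.Ico_subset_Icc_self hs)
  exact image_le_of_deriv_right_le_deriv_boundary
      (fun s hs => (hh s hs).continuousAt.continuousWithinAt)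
      (fun s hs => (hh s (Set.Ico_subset_Icc_self hs)).hasDerivWithinAt) h0
      (fun s hs => (hF s hs).continuousAt.continuousWithinAt)
      (fun s hs => (hF s (Set.Ico_subset_Icc_self hs)).hasDerivWithinAt)
      (fun s hs => key (Set.Ico_subset_Icc_self hs)) (Set.right_mem_Icc.2 hb)

theorem hasDerivAt_div_one_sub_mul {r s : ℝ} (hs : 1 - s * r ≠ 0) :
    HasDerivAt (fun τ : ℝ => r / (1 - τ * r)) (r ^ 2 / (1 - s * r) ^ 2) s :=
  ((hasDerivAt_const s r).div (((hasDerivAt_id s).mul_const r).const_sub 1) hs).congr_deriv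
    (by simp; ring)

/-! ### Self-concordance estimates in the local norm -/

namespace IsNondegenerateSelfConcordant

variable (hf : IsNondegenerateSelfConcordant f)
include hf

theorem nonneg (x v : E) : 0 ≤ fderiv ℝ (fderiv ℝ f) x v v := by
  rcases eq_or_ne v 0 with rfl | hv
  · simp
  · exact (hf.pos x v hv).le

theorem localNorm_sq (x v : E) : localNorm f x v ^ 2 = fderiv ℝ (fderiv ℝ f) x v v :=
  Real.sq_sqrt (hf.nonneg x v)

theorem localNorm_pos (x : E) {v : E} (hv : v ≠ 0) : 0 < localNorm f x v :=
  Real.sqrt_pos.2 (hf.pos x v hv)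

theorem abs_le_localNorm_mul (x u v : E) :
    |fderiv ℝ (fderiv ℝ f) x u v| ≤ localNorm f x u * localNorm f x v := by
  rcases eq_or_ne v 0 with rfl | hv
  · simp [localNorm]
  refine abs_le_of_sq_le_sq ?_ (mul_nonneg (localNorm_nonneg _ _ _) (localNorm_nonneg _ _ _))
  rw [mul_pow, hf.localNorm_sq, hf.localNorm_sq]
  have hv := hf.pos x v hv
  have h := hf.nonneg x (fderiv ℝ (fderiv ℝ f) x v v • u - fderiv ℝ (fderiv ℝ f) x u v • v)
  simp only [map_sub, map_smul, _root_.sub_apply, _root_.smul_apply,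
    smul_eq_mul, fderiv_fderiv_symm hf.contDiff x v u] at h
  nlinarith

/-- For ‖v‖ = 1, split u = pv + mw orthogonally in the local inner product and apply the binary
cubic bound on the span of v and w; here p² + m² = ‖u‖². The general case is by scaling v. -/
theorem abs_third_polar_le (x u v : E) :
    |fderiv ℝ (fderiv ℝ (fderiv ℝ f)) x u v v| ≤ 2 * localNorm f x u * localNorm f x v ^ 2 := by
  have hunit : ∀ v, localNorm f x v = 1 →
      |fderiv ℝ (fderiv ℝ (fderiv ℝ f)) x u v v| ≤ 2 * localNorm f x u := by
    intro v hv
    have hvv : fderiv ℝ (fderiv ℝ f) x v v = 1 := by rw [← hf.localNorm_sq, hv, one_pow]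
    set p := fderiv ℝ (fderiv ℝ f) x u v with hp
    set m := localNorm f x (u - p • v) with hm
    -- When u is a multiple of v, m⁻¹ = 0 and w = 0; this is why `hww` below asserts only ≤ 1.
    set w := m⁻¹ • (u - p • v) with hw
    have hu : u = p • v + m • w := by
      rcases eq_or_ne (u - p • v) 0 with h0 | h0
      · rw [hw, h0]; simpa [sub_eq_zero] using h0
      · rw [hw, smul_inv_smul₀ (hf.localNorm_pos x h0).ne']; abel
    have hwv : fderiv ℝ (fderiv ℝ f) x w v = 0 := by simp [hw, hvv, ← hp]
    have hvw : fderiv ℝ (fderiv ℝ f) x v w = 0 := by rw [fderiv_fderiv_symm hf.contDiff, hwv]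
    have hww : fderiv ℝ (fderiv ℝ f) x w w ≤ 1 := by
      have : fderiv ℝ (fderiv ℝ f) x w w = m⁻¹ ^ 2 * m ^ 2 := by
        rw [hm, hf.localNorm_sq, hw]; simp; ring
      rw [this, ← mul_pow]
      rcases eq_or_ne m 0 with h | h
      · simp [h]
      · simp [h]
    have hm2 : m ^ 2 = localNorm f x u ^ 2 - p ^ 2 := by
      rw [hm, hf.localNorm_sq, hf.localNorm_sq]
      simp [hvv, ← hp, fderiv_fderiv_symm hf.contDiff x v u]
      ring
    have hsw := fderiv_fderiv_fderiv_swap_left hf.contDiff x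
    have hsw' := fderiv_fderiv_fderiv_swap_right hf.contDiff x
    have key := abs_linear_le_of_abs_binary_cubic_le
      (a := fderiv ℝ (fderiv ℝ (fderiv ℝ f)) x v v v)
      (b := fderiv ℝ (fderiv ℝ (fderiv ℝ f)) x w v v)
      (c := fderiv ℝ (fderiv ℝ (fderiv ℝ f)) x w w v)
      (d := fderiv ℝ (fderiv ℝ (fderiv ℝ f)) x w w w) (M := 2) ?_ p m
    · rw [hm2, add_sub_cancel, Real.sqrt_sq (localNorm_nonneg _ _ _)] at key
      convert key using 2
      conv_lhs => rw [hu]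
      simp
    · intro s t hst
      have h1 := hf.abs_third_le x (s • v + t • w)
      have h2 : localNorm f x (s • v + t • w) ≤ 1 := by
        rw [localNorm, Real.sqrt_le_one]
        simp only [map_add, map_smul, _root_.add_apply,
          _root_.smul_apply, smul_eq_mul, hvv, hvw, hwv]
        nlinarith [sq_nonneg t]
      have h3 : localNorm f x (s • v + t • w) ^ 3 ≤ 1 := pow_le_one₀ (localNorm_nonneg _ _ _) h2
      refine le_trans (le_of_eq ?_) (h1.trans (by linarith : _ ≤ (2 : ℝ)))
      congr 1
      simp only [map_add, map_smul, _root_.add_apply,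
        _root_.smul_apply, smul_eq_mul]
      rw [hsw v w v, hsw' v v w, hsw v w v, hsw v w w, hsw' w v w]
      ring
  rcases eq_or_ne v 0 with rfl | hv
  · simp [localNorm]
  have hv' := hf.localNorm_pos x hv
  have h := hunit ((localNorm f x v)⁻¹ • v) (by
    rw [localNorm]
    simp only [map_smul, _root_.smul_apply, smul_eq_mul, ← hf.localNorm_sq]
    rw [Real.sqrt_eq_one]
    field_simp)
  simp only [map_smul, _root_.smul_apply, smul_eq_mul] at h
  rw [← mul_assoc, abs_mul, ← sq, abs_sq, inv_pow, inv_mul_le_iff₀ (by positivity)] at h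
  linarith

/-- The derivative of 1/‖d‖ along the line is at least -1, so 1/‖d‖ + τ is monotone in τ. -/
theorem localNorm_line_le {x d : E} {s : ℝ} (hs : 0 ≤ s) :
    localNorm f (x + s • d) d * (1 - s * localNorm f x d) ≤ localNorm f x d := by
  rcases eq_or_ne d 0 with rfl | hd
  · simp [localNorm]
  have hpos := fun y => hf.localNorm_pos y hd
  have hder : ∀ τ : ℝ, HasDerivAt (fun τ : ℝ => (localNorm f (x + τ • d) d)⁻¹ + τ)
      (-(fderiv ℝ (fderiv ℝ (fderiv ℝ f)) (x + τ • d) d d d / (2 * localNorm f (x + τ • d) d)) /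
        localNorm f (x + τ • d) d ^ 2 + 1) τ := fun τ =>
    (((hasDerivAt_fderiv_fderiv_line hf.contDiff x d d d τ).sqrt
      (hf.pos _ _ hd).ne').inv (hpos _).ne').add (hasDerivAt_id τ)
  have hmono := monotone_of_hasDerivAt_nonneg hder fun τ => by
    have h := (abs_le.1 (hf.abs_third_le (x + τ • d) d)).2
    have hp := hpos (x + τ • d)
    rw [Pi.zero_apply, neg_div, neg_add_eq_sub, sub_nonneg, div_div, div_le_one (by positivity)]
    linarith
  have h := hmono hs
  simp only [zero_smul, add_zero] at h
  have h0 := hpos x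
  have h1 := hpos (x + s • d)
  rw [inv_eq_one_div, inv_eq_one_div, div_add' _ _ _ h1.ne', div_le_div_iff₀ h0 h1] at h
  linarith

theorem abs_deriv_sq_localNorm_le {x d : E} {s : ℝ} (hs : 0 ≤ s) (hr : s * localNorm f x d < 1)
    (v : E) :
    |fderiv ℝ (fderiv ℝ (fderiv ℝ f)) (x + s • d) d v v| * (1 - s * localNorm f x d) ≤
      2 * localNorm f x d * fderiv ℝ (fderiv ℝ f) (x + s • d) v v := by
  have h1 := hf.abs_third_polar_le (x + s • d) d v
  rw [hf.localNorm_sq] at h1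
  have h2 := hf.localNorm_line_le (x := x) (d := d) hs
  have h3 := hf.nonneg (x + s • d) v
  have h4 : 0 ≤ 1 - s * localNorm f x d := by linarith
  calc _ ≤ 2 * localNorm f (x + s • d) d * fderiv ℝ (fderiv ℝ f) (x + s • d) v v *
        (1 - s * localNorm f x d) := by gcongr
    _ = 2 * (localNorm f (x + s • d) d * (1 - s * localNorm f x d)) *
        fderiv ℝ (fderiv ℝ f) (x + s • d) v v := by ring
    _ ≤ _ := by gcongr

/-- By the polar bound, |D³f[d,v,v]| ≤ 2r/(1-τr) · D²f[v,v] at x + τd, so (1-τr)² D²f[v,v] decreases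
in τ. -/
theorem localNorm_le_div {x d : E} {s : ℝ} (hs : 0 ≤ s) (hr : s * localNorm f x d < 1) (v : E) :
    localNorm f (x + s • d) v ≤ localNorm f x v / (1 - s * localNorm f x d) := by
  set r := localNorm f x d with hrdef
  have hr0 : 0 ≤ r := localNorm_nonneg _ _ _
  have hlt : ∀ τ ∈ Set.Icc 0 s, 0 < 1 - τ * r := fun τ hτ => by
    have := mul_le_mul_of_nonneg_right hτ.2 hr0
    linarith
  have hder : ∀ τ : ℝ, HasDerivAt
      (fun τ : ℝ => fderiv ℝ (fderiv ℝ f) (x + τ • d) v v * (1 - τ * r) ^ 2)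
      (fderiv ℝ (fderiv ℝ (fderiv ℝ f)) (x + τ • d) d v v * (1 - τ * r) ^ 2 +
        fderiv ℝ (fderiv ℝ f) (x + τ • d) v v * (2 * (1 - τ * r) * -r)) τ := fun τ => by
    refine ((hasDerivAt_fderiv_fderiv_line hf.contDiff x d v v τ).mul
      ((((hasDerivAt_id τ).mul_const r).const_sub 1).pow 2)).congr_deriv ?_
    simp
  have hanti := antitoneOn_of_deriv_nonpos (convex_Icc 0 s)
    (fun τ _ => (hder τ).continuousAt.continuousWithinAt)
    (fun τ _ => (hder τ).differentiableAt.differentiableWithinAt) fun τ hτ => by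
      have hτ := interior_subset hτ
      have h := hf.abs_deriv_sq_localNorm_le hτ.1 (by have := hlt τ hτ; linarith) v
      have h' := hlt τ hτ
      have h'' := mul_le_mul_of_nonneg_right (le_abs_self
        (fderiv ℝ (fderiv ℝ (fderiv ℝ f)) (x + τ • d) d v v)) h'.le
      rw [(hder τ).deriv]
      rw [← hrdef] at h
      nlinarith
  have h := hanti (Set.left_mem_Icc.2 hs) (Set.right_mem_Icc.2 hs) hs
  simp only [zero_smul, add_zero, zero_mul, sub_zero, one_pow, mul_one] at h
  have hp := hlt s (Set.right_mem_Icc.2 hs)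
  rw [le_div_iff₀ hp]
  refine abs_le_of_sq_le_sq' ?_ (localNorm_nonneg _ _ _) |>.2
  rwa [mul_pow, hf.localNorm_sq, hf.localNorm_sq]

/-- Same differential inequality, other sign: D²f[v,v]/(1-τr)² increases in τ. -/
theorem mul_localNorm_le {x d : E} {s : ℝ} (hs : 0 ≤ s) (hr : s * localNorm f x d < 1) (v : E) :
    (1 - s * localNorm f x d) * localNorm f x v ≤ localNorm f (x + s • d) v := by
  set r := localNorm f x d with hrdef
  have hr0 : 0 ≤ r := localNorm_nonneg _ _ _
  have hlt : ∀ τ ∈ Set.Icc 0 s, 0 < 1 - τ * r := fun τ hτ => by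
    have := mul_le_mul_of_nonneg_right hτ.2 hr0
    linarith
  have hder : ∀ τ ∈ Set.Icc 0 s, HasDerivAt
      (fun τ : ℝ => fderiv ℝ (fderiv ℝ f) (x + τ • d) v v / (1 - τ * r) ^ 2)
      ((fderiv ℝ (fderiv ℝ (fderiv ℝ f)) (x + τ • d) d v v * (1 - τ * r) ^ 2 -
        fderiv ℝ (fderiv ℝ f) (x + τ • d) v v * (2 * (1 - τ * r) * -r)) /
          ((1 - τ * r) ^ 2) ^ 2) τ := fun τ hτ => by
    refine ((hasDerivAt_fderiv_fderiv_line hf.contDiff x d v v τ).div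
      ((((hasDerivAt_id τ).mul_const r).const_sub 1).pow 2)
      (pow_ne_zero 2 (hlt τ hτ).ne')).congr_deriv ?_
    simp
  have hmono := monotoneOn_of_deriv_nonneg (convex_Icc 0 s)
    (fun τ hτ => (hder τ hτ).continuousAt.continuousWithinAt)
    (fun τ hτ => (hder τ (interior_subset hτ)).differentiableAt.differentiableWithinAt)
    fun τ hτ => by
      have hτ := interior_subset hτ
      have h := hf.abs_deriv_sq_localNorm_le hτ.1 (by have := hlt τ hτ; linarith) v
      have h' := hlt τ hτ
      have h'' := mul_le_mul_of_nonneg_right (neg_abs_le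
        (fderiv ℝ (fderiv ℝ (fderiv ℝ f)) (x + τ • d) d v v)) h'.le
      rw [(hder τ hτ).deriv]
      refine div_nonneg ?_ (by positivity)
      rw [← hrdef] at h
      nlinarith
  have h := hmono (Set.left_mem_Icc.2 hs) (Set.right_mem_Icc.2 hs) hs
  have hp := hlt s (Set.right_mem_Icc.2 hs)
  simp only [zero_smul, add_zero, zero_mul, sub_zero, one_pow, div_one] at h
  rw [le_div_iff₀ (by positivity)] at h
  refine abs_le_of_sq_le_sq' ?_ (localNorm_nonneg _ _ _) |>.2
  rw [mul_pow, hf.localNorm_sq, hf.localNorm_sq]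
  linarith

/-- Integrate φ'' ≤ r²/(1-sr)² twice. -/
theorem value_le {x d : E} {b : ℝ} (hb : 0 ≤ b) (hr : b * localNorm f x d < 1) :
    f (x + b • d) ≤ f x + b * fderiv ℝ f x d - b * localNorm f x d
      - Real.log (1 - b * localNorm f x d) := by
  set r := localNorm f x d with hrdef
  have hr0 : 0 ≤ r := localNorm_nonneg _ _ _
  have hlt : ∀ τ ∈ Set.Icc 0 b, 0 < 1 - τ * r := fun τ hτ => by
    have := mul_le_mul_of_nonneg_right hτ.2 hr0
    linarith
  refine le_of_second_deriv_le (h := fun s => f (x + s • d))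
    (h' := fun s => fderiv ℝ f (x + s • d) d)
    (h'' := fun s => fderiv ℝ (fderiv ℝ f) (x + s • d) d d)
    (F := fun s => f x + s * fderiv ℝ f x d - s * r - Real.log (1 - s * r))
    (F' := fun s => fderiv ℝ f x d - r + r / (1 - s * r))
    (F'' := fun s => r ^ 2 / (1 - s * r) ^ 2) hb
    (fun s _ => hasDerivAt_line hf.contDiff x d s)
    (fun s _ => hasDerivAt_fderiv_line hf.contDiff x d d s)
    (fun s hs => ?_) (fun s hs => ?_) (by simp) (by simp) (fun s hs => ?_)
  · refine (((((hasDerivAt_id s).mul_const _).const_add (f x)).sub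
      ((hasDerivAt_id s).mul_const r)).sub
      ((((hasDerivAt_id s).mul_const r).const_sub 1).log (hlt s hs).ne')).congr_deriv ?_
    simp [neg_div]
  · exact (hasDerivAt_div_one_sub_mul (hlt s hs).ne').const_add _
  · have h := hf.localNorm_le_div hs.1 (by have := hlt s hs; linarith) d
    rw [← hf.localNorm_sq, ← div_pow]
    exact pow_le_pow_left₀ (localNorm_nonneg _ _ _) h 2

/-- The second derivative in s of ⟨∇f(x+sd), w⟩ is D³f[d,d,w] ≤ 2‖w‖r²/(1-sr)³; integrate twice.
Replacing w by -w gives the absolute value. -/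
theorem gradient_remainder_le {x d : E} (hr : localNorm f x d < 1) (w : E) :
    |fderiv ℝ f (x + d) w - fderiv ℝ f x w - fderiv ℝ (fderiv ℝ f) x d w| ≤
      localNorm f x w * (localNorm f x d ^ 2 / (1 - localNorm f x d)) := by
  set r := localNorm f x d with hrdef
  have hr0 : 0 ≤ r := localNorm_nonneg _ _ _
  have hlt : ∀ τ ∈ Set.Icc (0 : ℝ) 1, 0 < 1 - τ * r := fun τ hτ => by
    have := mul_le_mul_of_nonneg_right hτ.2 hr0
    linarith
  have key : ∀ w, fderiv ℝ f (x + d) w - fderiv ℝ f x w - fderiv ℝ (fderiv ℝ f) x d w ≤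
      localNorm f x w * (r ^ 2 / (1 - r)) := by
    intro w
    have h := le_of_second_deriv_le
      (h := fun s => fderiv ℝ f (x + s • d) w - fderiv ℝ f x w -
        s * fderiv ℝ (fderiv ℝ f) x d w)
      (h' := fun s => fderiv ℝ (fderiv ℝ f) (x + s • d) d w - fderiv ℝ (fderiv ℝ f) x d w)
      (h'' := fun s => fderiv ℝ (fderiv ℝ (fderiv ℝ f)) (x + s • d) d d w)
      (F := fun s => localNorm f x w * ((1 - s * r)⁻¹ - 1 - s * r))
      (F' := fun s => localNorm f x w * (r / (1 - s * r) ^ 2 - r))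
      (F'' := fun s => localNorm f x w * (2 * r ^ 2 / (1 - s * r) ^ 3)) zero_le_one
      (fun s _ => ((hasDerivAt_fderiv_line hf.contDiff x d w s).sub_const _).sub
        (((hasDerivAt_id s).mul_const _).congr_deriv (one_mul _)))
      (fun s _ => (hasDerivAt_fderiv_fderiv_line hf.contDiff x d d w s).sub_const _)
      (fun s hs => ?_) (fun s hs => ?_) (by simp) (by simp) (fun s hs => ?_)
    · simp only [one_smul, one_mul] at h
      refine h.trans_eq ?_
      have := hlt 1 (by simp)
      rw [one_mul] at this
      field_simp
      ring
    · refine ((((((hasDerivAt_id s).mul_const r).const_sub 1).inv (hlt s hs).ne').sub_const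
        1).sub ((hasDerivAt_id s).mul_const r)).const_mul _ |>.congr_deriv ?_
      simp
    · refine (((hasDerivAt_const s r).div ((((hasDerivAt_id s).mul_const r).const_sub 1).pow 2)
        (pow_ne_zero 2 (hlt s hs).ne')).sub_const r).const_mul _ |>.congr_deriv ?_
      have := hlt s hs
      have h1 : 1 - r * s ≠ 0 := by rw [mul_comm]; exact this.ne'
      simp only [id, zero_mul, Pi.pow_apply]
      field_simp
      simp
      field_simp
    · have hp := hlt s hs
      have h1 := hf.localNorm_le_div (x := x) (d := d) hs.1 (by linarith) d
      have h2 := hf.localNorm_le_div (x := x) (d := d) hs.1 (by linarith) w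
      rw [fderiv_fderiv_fderiv_swap_right hf.contDiff,
        fderiv_fderiv_fderiv_swap_left hf.contDiff]
      rw [← hrdef] at h1 h2
      have h0 := localNorm_nonneg f (x + s • d) w
      have h0' := localNorm_nonneg f (x + s • d) d
      have h0'' := localNorm_nonneg f x w
      calc _ ≤ 2 * localNorm f (x + s • d) w * localNorm f (x + s • d) d ^ 2 :=
            (le_abs_self _).trans (hf.abs_third_polar_le _ _ _)
        _ ≤ 2 * (localNorm f x w / (1 - s * r)) * (r / (1 - s * r)) ^ 2 := by gcongr
        _ = _ := by field_simp
  refine abs_le.2 ⟨?_, key w⟩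
  have h := key (-w)
  rw [localNorm_neg] at h
  simp only [map_neg] at h
  linarith

end IsNondegenerateSelfConcordant

end

/-! ### Strict convexity and self-concordance make the Hessian definite -/

theorem _root_.StrictConvexOn.comp_line {E : Type*} [AddCommGroup E] [Module ℝ E] {f : E → ℝ}
    (hf : StrictConvexOn ℝ Set.univ f) (x : E) {u : E} (hu : u ≠ 0) :
    StrictConvexOn ℝ Set.univ fun s : ℝ => f (x + s • u) := by
  refine ⟨convex_univ, fun s _ t _ hst a b ha hb hab => ?_⟩
  have h := hf.2 (Set.mem_univ (x + s • u)) (Set.mem_univ (x + t • u))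
    (fun h => hst (smul_left_injective ℝ hu (add_left_cancel h))) ha hb hab
  convert h using 2
  rw [← eq_sub_iff_add_eq'] at hab
  subst hab
  module

variable {N n : ℕ} {f : EuclideanSpace ℝ (Fin N) → ℝ}

/-- If φ'' vanished at one point of a line, |φ'''| ≤ 2φ''^(3/2) ≤ 2Kφ'' on [0, 1] and Grönwall would
force φ'' = 0 there. Then φ' would be constant, contradicting its strict monotonicity. -/
theorem IsSelfConcordant.nondegenerate (hc : StrictConvexOn ℝ Set.univ f)
    (h : IsSelfConcordant 2 f) : IsNondegenerateSelfConcordant f := by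
  obtain ⟨-, hd, h3⟩ := h
  have hderiv : ∀ x u : EuclideanSpace ℝ (Fin N), deriv (fun s : ℝ => f (x + s • u)) =
      fun t => fderiv ℝ f (x + t • u) u :=
    fun x u => funext fun t => (hasDerivAt_line hd x u t).deriv
  have hmono : ∀ x u : EuclideanSpace ℝ (Fin N), u ≠ 0 →
      StrictMono fun t : ℝ => fderiv ℝ f (x + t • u) u := fun x u hu => by
    rw [← hderiv, ← strictMonoOn_univ]
    exact (hc.comp_line x hu).strictMonoOn_deriv
      fun t _ => (hasDerivAt_line hd x u t).differentiableAt
  have hnonneg : ∀ x u : EuclideanSpace ℝ (Fin N), 0 ≤ fderiv ℝ (fderiv ℝ f) x u u := by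
    intro x u
    rcases eq_or_ne u 0 with rfl | hu
    · simp
    · simpa using (hasDerivAt_fderiv_line hd x u u 0).nonneg_of_monotone (hmono x u hu).monotone
  have habs : ∀ x u : EuclideanSpace ℝ (Fin N),
      |fderiv ℝ (fderiv ℝ (fderiv ℝ f)) x u u u| ≤ 2 * localNorm f x u ^ 3 := by
    intro x u
    have := h3 x u 0
    rw [iteratedDeriv_two_line hd, iteratedDeriv_three_line hd] at this
    simp only [zero_smul, add_zero] at this
    rwa [localNorm, Real.sqrt_eq_rpow, ← Real.rpow_natCast, ← Real.rpow_mul (hnonneg x u),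
      show (1 / 2 * ((3 : ℕ) : ℝ)) = 3 / 2 by norm_num]
  refine ⟨hd, fun x u hu => (hnonneg x u).lt_of_ne' fun h0 => ?_, habs⟩
  have hder := fun t => hasDerivAt_fderiv_fderiv_line hd x u u u t
  have hcont : Continuous fun t : ℝ => fderiv ℝ (fderiv ℝ f) (x + t • u) u u :=
    continuous_iff_continuousAt.2 fun t => (hder t).continuousAt
  obtain ⟨K, hK⟩ := (isCompact_Icc (a := (0 : ℝ)) (b := 1)).bddAbove_image
    hcont.sqrt.continuousOn
  have hzero := eq_zero_of_abs_deriv_le_mul_abs_self_of_eq_zero_right (K := 2 * K)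
    hcont.continuousOn (fun t (_ : t ∈ Set.Ico (0 : ℝ) 1) => (hder t).hasDerivWithinAt)
    (by simpa using h0) fun t ht => by
      have hk : localNorm f (x + t • u) u ≤ K :=
        hK (Set.mem_image_of_mem _ (Set.Ico_subset_Icc_self ht))
      have hsq : localNorm f (x + t • u) u ^ 2 = fderiv ℝ (fderiv ℝ f) (x + t • u) u u :=
        Real.sq_sqrt (hnonneg _ _)
      rw [Real.norm_eq_abs, Real.norm_eq_abs, abs_of_nonneg (hnonneg _ _), ← hsq]
      refine (habs _ _).trans ?_
      have := mul_le_mul_of_nonneg_right hk (sq_nonneg (localNorm f (x + t • u) u))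
      linarith
  have hconst := constant_of_has_deriv_right_zero
    (f := fun t : ℝ => fderiv ℝ f (x + t • u) u) (a := 0) (b := 1)
    (fun t _ => (hasDerivAt_fderiv_line hd x u u t).continuousAt.continuousWithinAt)
    (fun t ht => by
      simpa only [hzero t (Set.Ico_subset_Icc_self ht)] using
        (hasDerivAt_fderiv_line hd x u u t).hasDerivWithinAt (s := Set.Ici t))
    1 (by simp)
  exact (hmono x u hu zero_lt_one).ne' hconst

/-! ### Galerkin direction, decrements and duality -/

theorem fderiv_eq_gradient_dotProduct (hf : Differentiable ℝ f) (x : EuclideanSpace ℝ (Fin N))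
    (b : Fin N → ℝ) : fderiv ℝ f x (WithLp.toLp 2 b) = (gradient f x).ofLp ⬝ᵥ b := by
  rw [(hf x).hasGradientAt.hasFDerivAt.fderiv, InnerProductSpace.toDual_apply_apply,
    EuclideanSpace.inner_eq_star_dotProduct, dotProduct_comm]
  simp

theorem fderiv_fderiv_eq_dotProduct_hessian (x : EuclideanSpace ℝ (Fin N)) (a b : Fin N → ℝ) :
    fderiv ℝ (fderiv ℝ f) x (WithLp.toLp 2 a) (WithLp.toLp 2 b) =
      a ⬝ᵥ (hessian f x *ᵥ b) := by
  have hs : ∀ a : Fin N → ℝ, WithLp.toLp 2 a = ∑ i, a i • EuclideanSpace.single i (1 : ℝ) := by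
    intro a
    ext j
    simp [Finset.sum_apply, Pi.single_apply]
  rw [hs a, hs b]
  simp only [map_sum, map_smul, _root_.sum_apply, _root_.smul_apply, smul_eq_mul,
    dotProduct, mulVec, hessian, of_apply, Finset.mul_sum]
  rw [Finset.sum_comm]
  exact Finset.sum_congr rfl fun i _ => Finset.sum_congr rfl fun j _ => by ring

theorem exists_coarseDirection_eq (f : EuclideanSpace ℝ (Fin N) → ℝ)
    (P : Matrix (Fin N) (Fin n) ℝ) (x : EuclideanSpace ℝ (Fin N)) :
    ∃ y, coarseDirection f P x = WithLp.toLp 2 (P *ᵥ y) :=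
  ⟨-((reducedHessian f P x)⁻¹ *ᵥ reducedGradient f P x), by rw [coarseDirection, mulVec_neg]⟩

/-- Lets every fact about λ̂ and the coarse direction apply to λ and the Newton direction. -/
theorem newtonDecrement_eq_approxDecrement_one (f : EuclideanSpace ℝ (Fin N) → ℝ)
    (x : EuclideanSpace ℝ (Fin N)) :
    newtonDecrement f x = approxDecrement f (1 : Matrix (Fin N) (Fin N) ℝ) x := by
  simp [newtonDecrement, approxDecrement, reducedGradient, reducedHessian]

namespace IsNondegenerateSelfConcordant

variable (hf : IsNondegenerateSelfConcordant f)
include hf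

theorem hessian_posDef (x : EuclideanSpace ℝ (Fin N)) : (hessian f x).PosDef := by
  refine PosDef.of_dotProduct_mulVec_pos ?_ fun v hv => ?_
  · ext i j
    simpa [hessian] using fderiv_fderiv_symm hf.contDiff x _ _
  · rw [star_trivial, ← fderiv_fderiv_eq_dotProduct_hessian]
    exact hf.pos x _ (by simpa using hv)

variable {P : Matrix (Fin N) (Fin n) ℝ} (hP : Function.Injective P.mulVec)
include hP

theorem reducedHessian_mulVec_inv (x : EuclideanSpace ℝ (Fin N)) (v : Fin n → ℝ) :
    reducedHessian f P x *ᵥ ((reducedHessian f P x)⁻¹ *ᵥ v) = v := by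
  have h := ((hf.hessian_posDef x).conjTranspose_mul_mul_same hP).isUnit
  rw [conjTranspose_eq_transpose_of_trivial] at h
  rw [mulVec_mulVec, reducedHessian, mul_nonsing_inv _ ((isUnit_iff_isUnit_det _).1 h),
    one_mulVec]

/-- The Galerkin equation: d solves the Newton equation tested on the range of P. -/
theorem fderiv_fderiv_coarseDirection (x : EuclideanSpace ℝ (Fin N)) (y : Fin n → ℝ) :
    fderiv ℝ (fderiv ℝ f) x (coarseDirection f P x) (WithLp.toLp 2 (P *ᵥ y)) =
      -fderiv ℝ f x (WithLp.toLp 2 (P *ᵥ y)) := by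
  rw [fderiv_fderiv_symm hf.contDiff, coarseDirection, fderiv_fderiv_eq_dotProduct_hessian,
    fderiv_eq_gradient_dotProduct (hf.contDiff.differentiable (by norm_num)), mulVec_neg,
    dotProduct_neg, neg_inj, ← vecMul_transpose, ← dotProduct_mulVec, mulVec_mulVec,
    mulVec_mulVec, ← reducedHessian, hf.reducedHessian_mulVec_inv hP, reducedGradient,
    dotProduct_mulVec, vecMul_transpose, dotProduct_comm]

theorem fderiv_coarseDirection (x : EuclideanSpace ℝ (Fin N)) :
    fderiv ℝ f x (coarseDirection f P x) = -localNorm f x (coarseDirection f P x) ^ 2 := by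
  rw [hf.localNorm_sq]
  obtain ⟨y, hy⟩ := exists_coarseDirection_eq f P x
  have h := hf.fderiv_fderiv_coarseDirection hP x y
  rw [← hy] at h
  rw [h, neg_neg]

theorem approxDecrement_eq_localNorm (x : EuclideanSpace ℝ (Fin N)) :
    approxDecrement f P x = localNorm f x (coarseDirection f P x) := by
  rw [← Real.sqrt_sq (localNorm_nonneg f x _), ← neg_neg (localNorm f x _ ^ 2),
    ← hf.fderiv_coarseDirection hP, coarseDirection,
    fderiv_eq_gradient_dotProduct (hf.contDiff.differentiable (by norm_num)),
    dotProduct_neg, neg_neg, dotProduct_mulVec, ← mulVec_transpose, approxDecrement,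
    ← reducedGradient]

/-- λ̂ is at most the dual norm of the gradient on the range of P; testing on d itself gives λ̂² ≤
cλ̂. -/
theorem approxDecrement_le {x : EuclideanSpace ℝ (Fin N)} {c : ℝ} (hc : 0 ≤ c)
    (h : ∀ y, |fderiv ℝ f x (WithLp.toLp 2 (P *ᵥ y))| ≤
      c * localNorm f x (WithLp.toLp 2 (P *ᵥ y))) : approxDecrement f P x ≤ c := by
  obtain ⟨y, hy⟩ := exists_coarseDirection_eq f P x
  have h := h y
  rw [← hy, hf.fderiv_coarseDirection hP, abs_neg, abs_sq] at h
  rw [hf.approxDecrement_eq_localNorm hP]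
  have h0 := localNorm_nonneg f x (coarseDirection f P x)
  by_contra! hlt
  nlinarith

/-- The residual `∇f(x) + ∇²f(x) d` of the coarse step is at most `√(λ² - λ̂²)` in the dual of
the local norm. -/
theorem abs_fderiv_add_fderiv_fderiv_le (x w : EuclideanSpace ℝ (Fin N)) :
    approxDecrement f P x ≤ newtonDecrement f x ∧
    |fderiv ℝ f x w + fderiv ℝ (fderiv ℝ f) x (coarseDirection f P x) w| ≤
      √(newtonDecrement f x ^ 2 - approxDecrement f P x ^ 2) * localNorm f x w := by
  have h1 : Function.Injective (1 : Matrix (Fin N) (Fin N) ℝ).mulVec := fun a b h => by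
    simpa using h
  rw [newtonDecrement_eq_approxDecrement_one, hf.approxDecrement_eq_localNorm h1,
    hf.approxDecrement_eq_localNorm hP]
  have hd := hf.fderiv_coarseDirection hP x
  set z := coarseDirection f (1 : Matrix (Fin N) (Fin N) ℝ) x
  have hn : ∀ v, fderiv ℝ (fderiv ℝ f) x z v = -fderiv ℝ f x v :=
    fun v => by simpa using hf.fderiv_fderiv_coarseDirection h1 x v.ofLp
  -- Pythagoras for the projection d of the Newton direction z. The residual paired with w is D²f[d
  -- - z, w], to which Cauchy–Schwarz applies.
  have hsq : localNorm f x (coarseDirection f P x - z) ^ 2 =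
      localNorm f x z ^ 2 - localNorm f x (coarseDirection f P x) ^ 2 := by
    have h1' := hn (coarseDirection f P x)
    rw [hd, neg_neg] at h1'
    rw [hf.localNorm_sq x (_ - _), hf.localNorm_sq x z]
    simp only [map_sub, _root_.sub_apply, h1',
      fderiv_fderiv_symm hf.contDiff x (coarseDirection f P x) z]
    rw [← hf.localNorm_sq x (coarseDirection f P x)]
    ring
  refine ⟨?_, ?_⟩
  · have := sq_nonneg (localNorm f x (coarseDirection f P x - z))
    exact (sq_le_sq₀ (localNorm_nonneg _ _ _) (localNorm_nonneg _ _ _)).1 (by linarith)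
  · rw [← hsq, Real.sqrt_sq (localNorm_nonneg _ _ _)]
    refine le_trans (le_of_eq ?_) (hf.abs_le_localNorm_mul x _ w)
    rw [map_sub, _root_.sub_apply, hn]
    congr 1
    ring

/-! ### Effect of a unit coarse step on the decrements -/

theorem decrement_coarse_step {μ : ℝ} (hμ : μ ∈ Set.Ioo (0 : ℝ) 1)
    {x : EuclideanSpace ℝ (Fin N)} (hμx : μ * newtonDecrement f x < approxDecrement f P x)
    (hpos : 0 < approxDecrement f P x) (hle : approxDecrement f P x ≤ fastRadius μ) :
    approxDecrement f P (x + coarseDirection f P x) < approxDecrement f P x ∧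
    newtonDecrement f (x + coarseDirection f P x) < newtonDecrement f x ∧
    newtonDecrement f (x + coarseDirection f P x) ≤
      (contraction μ + approxDecrement f P x) / (1 - approxDecrement f P x) ^ 2 *
        newtonDecrement f x := by
  have h1 : Function.Injective (1 : Matrix (Fin N) (Fin N) ℝ).mulVec := fun a b h => by
    simpa using h
  have he2 : contraction μ ^ 2 = 1 - μ ^ 2 := Real.sq_sqrt (by nlinarith [hμ.1, hμ.2])
  have he : 0 < contraction μ := Real.sqrt_pos.2 (by nlinarith [hμ.1, hμ.2])
  set d := coarseDirection f P x with hd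
  have hr := hf.approxDecrement_eq_localNorm hP x
  have hle' := (hf.abs_fderiv_add_fderiv_fderiv_le hP x 0).1
  have hres := fun w => (hf.abs_fderiv_add_fderiv_fderiv_le hP x w).2
  rw [← hd] at hres
  set r := approxDecrement f P x
  set l := newtonDecrement f x
  set e := contraction μ
  -- The number `fastRadius μ` is the smaller root of e + r = (1 - r)².
  have hfast : e + r ≤ (1 - r) ^ 2 ∧ r < 1 / 2 := by
    have h5 := Real.sq_sqrt (show 0 ≤ 5 + 4 * e by linarith)
    have hlow : 2 < √(5 + 4 * e) := Real.lt_sqrt_of_sq_lt (by linarith)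
    rw [fastRadius] at hle
    constructor <;> nlinarith
  have hr1 : 0 < 1 - r := by linarith [hfast.2]
  have hl : 0 < l := hpos.trans_le hle'
  have hsqrt : √(l ^ 2 - r ^ 2) ≤ e * l := by
    refine Real.sqrt_le_iff.2 ⟨by positivity, ?_⟩
    rw [mul_pow, he2]
    have : (μ * l) ^ 2 ≤ r ^ 2 := pow_le_pow_left₀ (mul_nonneg hμ.1.le hl.le) hμx.le 2
    linarith
  have hnorm : ∀ w, localNorm f x w ≤ localNorm f (x + d) w / (1 - r) := fun w => by
    have h := hf.mul_localNorm_le (x := x) (d := d) zero_le_one (by rw [← hr]; linarith) w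
    rw [one_mul, one_smul, ← hr] at h
    rw [le_div_iff₀ hr1]
    linarith
  have hrem : ∀ w, |fderiv ℝ f (x + d) w - fderiv ℝ f x w - fderiv ℝ (fderiv ℝ f) x d w| ≤
      localNorm f x w * (r ^ 2 / (1 - r)) := fun w => by
    have h := hf.gradient_remainder_le (x := x) (d := d) (by rw [← hr]; linarith) w
    rwa [← hr] at h
  have ha : approxDecrement f P (x + d) ≤ r ^ 2 / (1 - r) / (1 - r) := by
    refine hf.approxDecrement_le hP (by positivity) fun y => ?_
    have h := hrem (WithLp.toLp 2 (P *ᵥ y))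
    rw [hf.fderiv_fderiv_coarseDirection hP, sub_neg_eq_add, sub_add_cancel] at h
    calc _ ≤ _ := h
      _ ≤ localNorm f (x + d) (WithLp.toLp 2 (P *ᵥ y)) / (1 - r) * (r ^ 2 / (1 - r)) := by
        gcongr
        exact hnorm _
      _ = _ := by ring
  have hn : newtonDecrement f (x + d) ≤ (e * l + r ^ 2 / (1 - r)) / (1 - r) := by
    rw [newtonDecrement_eq_approxDecrement_one]
    refine hf.approxDecrement_le h1 (by positivity) fun y => ?_
    rw [one_mulVec]
    set w : EuclideanSpace ℝ (Fin N) := WithLp.toLp 2 y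
    have hw := localNorm_nonneg f x w
    calc |fderiv ℝ f (x + d) w| =
          |(fderiv ℝ f x w + fderiv ℝ (fderiv ℝ f) x d w) +
          (fderiv ℝ f (x + d) w - fderiv ℝ f x w - fderiv ℝ (fderiv ℝ f) x d w)| := by
            congr 1; ring
      _ ≤ _ := abs_add_le _ _
      _ ≤ e * l * localNorm f x w + localNorm f x w * (r ^ 2 / (1 - r)) :=
        add_le_add ((hres w).trans (mul_le_mul_of_nonneg_right hsqrt hw)) (hrem w)
      _ = (e * l + r ^ 2 / (1 - r)) * localNorm f x w := by ring
      _ ≤ (e * l + r ^ 2 / (1 - r)) * (localNorm f (x + d) w / (1 - r)) := by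
        gcongr
        exact hnorm w
      _ = _ := by ring
  have hn' : newtonDecrement f (x + d) < (e + r) / (1 - r) ^ 2 * l := by
    refine hn.trans_lt ?_
    -- It remains to see el(1-r) + r² < (e+r)l: use r ≤ l, and elr > 0 for strictness.
    rw [show (e * l + r ^ 2 / (1 - r)) / (1 - r) = (e * l * (1 - r) + r ^ 2) / (1 - r) ^ 2 by
      field_simp, div_mul_eq_mul_div]
    refine div_lt_div_of_pos_right ?_ (by positivity)
    have h2 : 0 < e * l * r := by positivity
    nlinarith
  refine ⟨ha.trans_lt ?_, hn'.trans_le ?_, hn'.le⟩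
  · rw [div_div, div_lt_iff₀ (by positivity)]
    nlinarith [hfast.1]
  · refine mul_le_of_le_one_left hl.le ?_
    exact (div_le_one (by positivity)).2 hfast.1

/-! ### Line search -/

omit hP in
-- For r > 0, the step 1/(1+r) minimises the upper bound of `value_le`, and there the bound falls
-- below f(x) by at least half of r²/(1+r); α < 1/2 suffices.
theorem armijo_inv_one_add {x d : EuclideanSpace ℝ (Fin N)} {α : ℝ} (hα : α < 1 / 2)
    (hd : fderiv ℝ f x d = -localNorm f x d ^ 2) :
    f (x + (1 + localNorm f x d)⁻¹ • d) ≤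
      f x + α * (1 + localNorm f x d)⁻¹ * fderiv ℝ f x d := by
  have hr := localNorm_nonneg f x d
  have h := hf.value_le (x := x) (d := d) (b := (1 + localNorm f x d)⁻¹) (by positivity) (by
    rw [inv_mul_lt_one₀ (by positivity)]; linarith)
  rw [hd] at h ⊢
  set r := localNorm f x d
  have h1 : 1 - (1 + r)⁻¹ * r = (1 + r)⁻¹ := by field_simp; ring
  rw [h1, Real.log_inv, sub_neg_eq_add] at h
  -- y ≤ sinh y at y = log(1+r) reads log(1+r) ≤ ((1+r) - 1/(1+r))/2.
  have h2 := Real.self_le_sinh_iff.2 (Real.log_nonneg (show 1 ≤ 1 + r by linarith))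
  rw [Real.sinh_log (by positivity)] at h2
  have h3 : (1 + r)⁻¹ * -r ^ 2 - (1 + r)⁻¹ * r + (1 + r - (1 + r)⁻¹) / 2 =
      -(1 / 2 * ((1 + r)⁻¹ * r ^ 2)) := by field_simp; ring
  have h4 : α * ((1 + r)⁻¹ * r ^ 2) ≤ 1 / 2 * ((1 + r)⁻¹ * r ^ 2) :=
    mul_le_mul_of_nonneg_right hα.le (by positivity)
  linarith

omit hP in
-- For r ≤ 2/5, -log(1-r) ≤ r + r²/2 + r³, so the decrease is at least r²(1/2 - r), which is at
-- least αr² when r ≤ (1-2α)/2.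
theorem armijo_one {x d : EuclideanSpace ℝ (Fin N)} {α : ℝ}
    (hd : fderiv ℝ f x d = -localNorm f x d ^ 2)
    (hr1 : localNorm f x d ≤ (1 - 2 * α) / 2) (hr2 : localNorm f x d ≤ 2 / 5) :
    f (x + d) ≤ f x + α * fderiv ℝ f x d := by
  have hr := localNorm_nonneg f x d
  have h := hf.value_le (x := x) (d := d) zero_le_one (by linarith)
  rw [hd, one_smul, one_mul, one_mul] at h
  rw [hd]
  set r := localNorm f x d
  have hlog := Real.abs_log_sub_add_sum_range_le (x := r) (by rw [abs_of_nonneg hr]; linarith) 3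
  simp only [Finset.sum_range_succ, Finset.sum_range_zero, abs_of_nonneg hr] at hlog
  norm_num at hlog
  -- The cutoff 2/5 makes r/(1-r) ≤ 2/3, so that this tail and r³/3 add up to r³.
  have h4 : r ^ 4 / (1 - r) ≤ 2 / 3 * r ^ 3 := by
    rw [div_le_iff₀ (by linarith)]
    have := pow_nonneg hr 3
    nlinarith
  have h5 := (abs_le.1 hlog).1
  have h6 : 0 ≤ r ^ 2 * ((1 - 2 * α) / 2 - r) := mul_nonneg (sq_nonneg r) (by linarith)
  nlinarith

end IsNondegenerateSelfConcordant

/-- By convexity, a positive step that passes makes all smaller nonnegative steps pass. -/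
theorem Armijo.of_le {α t s : ℝ} {x d : EuclideanSpace ℝ (Fin N)} (hc : ConvexOn ℝ Set.univ f)
    (h : Armijo α f x d t) (hs : 0 ≤ s) (hst : s ≤ t) (ht : 0 < t) : Armijo α f x d s := by
  have hst1 : s / t ≤ 1 := (div_le_one ht).2 hst
  have h1 := hc.2 (Set.mem_univ x) (Set.mem_univ (x + t • d)) (sub_nonneg.2 hst1)
    (div_nonneg hs ht.le) (sub_add_cancel 1 (s / t))
  have h2 : (1 - s / t) • x + (s / t) • (x + t • d) = x + s • d := by
    rw [smul_add, smul_smul, div_mul_cancel₀ _ ht.ne', ← add_assoc, ← add_smul, sub_add_cancel,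
      one_smul]
  rw [h2] at h1
  have h3 := mul_le_mul_of_nonneg_left h (div_nonneg hs ht.le)
  have h4 : s / t * (α * t * inner ℝ (gradient f x) d) = α * s * inner ℝ (gradient f x) d := by
    field_simp
  simp only [smul_eq_mul] at h1
  rw [Armijo]
  linarith

theorem IsBacktrackingStep.eq_one {α β t : ℝ} {x d : EuclideanSpace ℝ (Fin N)}
    (h : IsBacktrackingStep α β f x d t) (h1 : Armijo α f x d 1) : t = 1 := by
  obtain ⟨j, rfl, -, hj⟩ := h
  rcases j.eq_zero_or_pos with rfl | hpos
  · simp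
  · exact absurd (by simpa using h1) (hj 0 hpos)

/-- If t < 1, the previous trial t/β was rejected, so it exceeds the acceptable s. -/
theorem IsBacktrackingStep.le {α β t s : ℝ} {x d : EuclideanSpace ℝ (Fin N)}
    (h : IsBacktrackingStep α β f x d t) (hc : ConvexOn ℝ Set.univ f)
    (hβ : β ∈ Set.Ioo (0 : ℝ) 1) (hs : 0 < s) (hs1 : s ≤ 1) (hA : Armijo α f x d s) :
    β * s ≤ t := by
  obtain ⟨j, rfl, -, hj⟩ := h
  rcases j with _ | j
  · rw [pow_zero]
    nlinarith [hβ.1, hβ.2]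
  · rw [pow_succ']
    refine mul_le_mul_of_nonneg_left ?_ hβ.1.le
    by_contra! hlt
    exact hj j (Nat.lt_succ_self j) (hA.of_le hc (pow_nonneg hβ.1.le j) hlt.le hs)

theorem fastRadius_mem {μ : ℝ} (hμ : μ ∈ Set.Ioo (0 : ℝ) 1) :
    fastRadius μ ∈ Set.Ioo (0 : ℝ) ((3 - √5) / 2) := by
  have he : 0 < contraction μ := Real.sqrt_pos.2 (by nlinarith [hμ.1, hμ.2])
  have he1 : contraction μ < 1 := by
    rw [contraction, Real.sqrt_lt' one_pos]
    nlinarith [hμ.1]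
  have h1 : √5 < √(5 + 4 * contraction μ) := Real.sqrt_lt_sqrt (by norm_num) (by linarith)
  have h2 : √(5 + 4 * contraction μ) < 3 := (Real.sqrt_lt' (by norm_num)).2 (by linarith)
  constructor <;> rw [fastRadius] <;> linarith

theorem _root_.Matrix.mulVec_injective_of_rank_eq {m n : ℕ} {P : Matrix (Fin m) (Fin n) ℝ}
    (hP : P.rank = n) : Function.Injective P.mulVec := by
  have h := P.mulVecLin.finrank_range_add_finrank_ker
  rw [← Matrix.rank, hP, Module.finrank_fin_fun, Nat.add_eq_left, Submodule.finrank_eq_zero] at h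
  exact LinearMap.ker_eq_bot.1 h

end SIGMA

end

/-! ### Assembly of the two phases -/

theorem mainTheorem1 (μ α β : ℝ) (hμ : μ ∈ Set.Ioo (0 : ℝ) 1)
    (hα : α ∈ Set.Ioo (0 : ℝ) (1 / 2)) (hβ : β ∈ Set.Ioo (0 : ℝ) 1) :
    ∃ γ η : ℝ, 0 < γ ∧ η ∈ Set.Ioo (0 : ℝ) ((3 - √5) / 2) ∧
      η = min (SIGMA.fastRadius μ) ((1 - 2 * α) / 2) ∧
      ∀ (ν ε : ℝ), ν ∈ Set.Ioo (0 : ℝ) (0.68 ^ 2) → ε ∈ Set.Ioo ν (0.68 ^ 2) →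
      ∀ (N n : ℕ) (f : EuclideanSpace ℝ (Fin N) → ℝ) (P : Matrix (Fin N) (Fin n) ℝ),
      StrictConvexOn ℝ Set.univ f → SIGMA.IsSelfConcordant 2 f → P.rank = n →
      ∀ (K : ℕ∞) (x : ℕ → EuclideanSpace ℝ (Fin N)) (t : ℕ → ℝ),
      SIGMA.IsRun μ α β ν ε f P K x t →
      ∀ k : ℕ, (k : ℕ∞) < K → SIGMA.UsesCoarse μ ν f P (x k) →
        (η < SIGMA.approxDecrement f P (x k) → f (x (k + 1)) - f (x k) ≤ -γ) ∧
        (SIGMA.approxDecrement f P (x k) ≤ η →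
          t k = 1 ∧
          SIGMA.approxDecrement f P (x (k + 1)) < SIGMA.approxDecrement f P (x k) ∧
          SIGMA.newtonDecrement f (x (k + 1)) < SIGMA.newtonDecrement f (x k) ∧
          SIGMA.newtonDecrement f (x (k + 1)) ≤
            (SIGMA.contraction μ + SIGMA.approxDecrement f P (x k)) /
              (1 - SIGMA.approxDecrement f P (x k)) ^ 2 * SIGMA.newtonDecrement f (x k)) ∧
        (SIGMA.approxDecrement f P (x k) ≤ SIGMA.fastRadius μ → t k = 1 →
          SIGMA.approxDecrement f P (x (k + 1)) < SIGMA.approxDecrement f P (x k) ∧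
          SIGMA.newtonDecrement f (x (k + 1)) < SIGMA.newtonDecrement f (x k) ∧
          SIGMA.newtonDecrement f (x (k + 1)) ≤
            (SIGMA.contraction μ + SIGMA.approxDecrement f P (x k)) /
              (1 - SIGMA.approxDecrement f P (x k)) ^ 2 * SIGMA.newtonDecrement f (x k)) := by
  have hfr := SIGMA.fastRadius_mem hμ
  obtain ⟨η, hη⟩ : ∃ η, η = min (SIGMA.fastRadius μ) ((1 - 2 * α) / 2) := ⟨_, rfl⟩
  have hη0 : 0 < η := by
    rw [hη]
    exact lt_min hfr.1 (by linarith [hα.2])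
  have hηfr : η ≤ SIGMA.fastRadius μ := hη ▸ min_le_left _ _
  have hηα : η ≤ (1 - 2 * α) / 2 := hη ▸ min_le_right _ _
  have hα0 := hα.1
  have hβ0 := hβ.1
  -- The decrease is at least αtr² with t ≥ β/(1+r); r²/(1+r) increases in r, so its value at r = η
  -- gives γ.
  refine ⟨α * (β * (1 + η)⁻¹) * η ^ 2, η, by positivity, ⟨hη0, hηfr.trans_lt hfr.2⟩, hη,
    fun ν ε hν _ N n f P hconv hsc hrank K x t hrun k hk hcoarse => ?_⟩
  have hf := hsc.nondegenerate hconv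
  have hP := Matrix.mulVec_injective_of_rank_eq hrank
  have hdir : SIGMA.direction μ ν f P (x k) = SIGMA.coarseDirection f P (x k) :=
    if_pos hcoarse
  have hls := hrun.lineSearch k hk
  have hupd := hrun.update k hk
  rw [hdir] at hls hupd
  have hinner : ∀ d, inner ℝ (gradient f (x k)) d = fderiv ℝ f (x k) d := fun d => by
    rw [((hf.contDiff.differentiable (by norm_num)) (x k)).hasGradientAt.hasFDerivAt.fderiv,
      InnerProductSpace.toDual_apply_apply]
  have hd := hf.fderiv_coarseDirection hP (x k)
  have hr := hf.approxDecrement_eq_localNorm hP (x k)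
  have hpos : 0 < SIGMA.approxDecrement f P (x k) := hν.1.trans hcoarse.2
  have hfast := fun h (ht : t k = 1) => by
    have := hf.decrement_coarse_step hP hμ hcoarse.1 hpos h
    rw [ht, one_smul] at hupd
    rwa [← hupd] at this
  refine ⟨fun hlt => ?_, fun hle => ?_, hfast⟩
  · have hA := hf.armijo_inv_one_add hα.2 hd
    rw [← hr] at hA hd
    have hs := hls.le hconv.convexOn hβ
      (s := (1 + SIGMA.approxDecrement f P (x k))⁻¹) (by positivity)
      (inv_le_one_of_one_le₀ (by linarith)) (by rwa [SIGMA.Armijo, hinner])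
    obtain ⟨j, htj, hAj, -⟩ := hls
    rw [← htj, SIGMA.Armijo, hinner, hd, ← hupd] at hAj
    generalize SIGMA.approxDecrement f P (x k) = r at *
    have hr0 : (1 + η)⁻¹ * η ^ 2 ≤ (1 + r)⁻¹ * r ^ 2 := by
      rw [inv_mul_eq_div, inv_mul_eq_div, div_le_div_iff₀ (by positivity) (by positivity)]
      nlinarith [mul_pos hη0 hpos]
    have h1 : α * β * ((1 + η)⁻¹ * η ^ 2) ≤ α * β * ((1 + r)⁻¹ * r ^ 2) := by gcongr
    have h2 : α * (β * (1 + r)⁻¹) * r ^ 2 ≤ α * t k * r ^ 2 := by gcongr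
    linarith
  · have ht : t k = 1 := hls.eq_one (by
      rw [SIGMA.Armijo, hinner, one_smul, mul_one]
      -- This gives (3-√5)/2 ≤ 2/5, the cutoff that `armijo_one` needs.
      have h5 : (11 / 5 : ℝ) ≤ √5 := Real.le_sqrt_of_sq_le (by norm_num)
      exact hf.armijo_one hd (hr ▸ hle.trans hηα)
        (by rw [← hr]; linarith [hfr.2]))
    exact ⟨ht, hfast (hle.trans hηfr) ht⟩
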